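/- Setting. A point process $\Phi$ on $\mathbb{R}^2$ is a random locally finite subset of $\mathbb{R}^2$, with law $P_\Phi$ on the space of such subsets equipped with the $\sigma$-algebra generated by the counts $\Phi(B)$, $B$ Borel; $o$ is the origin and $b(o,r)=\{x:\|x\|<r\}$. For stationary $\Phi$ with intensity $\lambda\in(0,\infty)$, let $\Phi^\zeta=(\Phi\mid\zeta\in\Phi)$ have the Palm distribution at $\zeta$, i.e. the law of $\Phi^{o}+\zeta$, where $\mathbb{P}(\Phi^{o}\in A)=\lambda^{-1}\,\mathbb{E}\sum_{x\in\Phi\cap[0,1)^2}\mathbf 1_A(\Phi-x)$. For $\zeta\neq o$ let $\Phi_o^\zeta$ be $\Phi^\zeta$ conditioned on $\zeta$ being a nearest point to $o$ (this is $\Phi$ conditioned on its nearest point to $o$ being $\zeta$). Let $\alpha>2$ and let $\ell(x)=(1+\|x\|^{\alpha})^{-1}$ or $\ell(x)=\|x\|^{-\alpha}$. Let the fading be composite: given the points, the variables $h_x$ are i.i.d. copies of $h=\tilde h\,10^{X/10}$, where $\tilde h$ is gamma distributed with shape $m>0$ and scale $1/m$, $X\sim N(0,\sigma^2)$ with $\sigma>0$,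 and $\tilde h$, $X$ are independent. Put $$I_\zeta=\sum_{x\in\Phi_o^\zeta\setminus\{\zeta\}}h_x\,\ell(x),\qquad \hat I_\zeta=\sum_{x\in\Phi^\zeta\setminus(\{\zeta\}\cup b(o,\|\zeta\|/2))}h_x\,\ell(x).$$ Let $\mathcal{A}$ be the set of laws $P_\Phi$ of point processes that are invariant under translations and under rotations about $o$, are mixing ($P_\Phi(A\cap T_v B)\to P_\Phi(A)P_\Phi(B)$ as $\|v\|\to\infty$ for all events $A,B$, where $T_v$ denotes translation by $v$), and satisfy: 1. for every $n\ge2$ the $n$-th factorial moment measure of $\Phi$ has a density $\rho^{(n)}$ with respect to Lebesgue measure with $\rho^{(n)}<q_n$ for some $q_n<\infty$; 2. for every $y>0$ there is $\zeta$ with $\|\zeta\|=y$ and $\mathbb{P}(\Phi^\zeta(b(o,y))=0)\neq0$; 3. there is $y_0>0$ such that $\mathbb{P}(I_\zeta>z)\le\mathbb{P}(\hat I_\zeta>z)$ for all $z\ge0$ and all $\zeta$ with $\|\zeta\|>y_0$; 4. for every $n\in\mathbb{N}$, the distance $\xi$ from $o$ to the nearest point of $\Phi$ has $\mathbb{E}(\xi^n)<\infty$.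 Statement. If $P_\Phi\in\mathcal{A}$, then for every $\zeta\in\mathbb{R}^2\setminus\{o\}$ and every $\beta\in\mathbb{N}$, the complementary distribution function $F^{\rm c}_{I_\zeta}(y)=\mathbb{P}(I_\zeta>y)$ of the interference satisfies $$F^{\rm c}_{I_\zeta}(y)=o(y^{-\beta})\qquad\text{as }y\to+\infty.$$ -/

import Mathlib

open MeasureTheory ProbabilityTheory Filter Topology Asymptotics
open scoped ENNReal NNReal

namespace CellularNetwork

noncomputable section

/-! ### Point patterns and point processes in the plane -/

/-- The Euclidean plane. -/
abbrev Plane : Type := EuclideanSpace ℝ (Fin 2)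

/-- A point pattern: a locally finite subset of the plane. -/
@[ext]
structure PointPattern where
  carrier : Set Plane
  locallyFinite : ∀ r : ℝ, (carrier ∩ Metric.closedBall 0 r).Finite

namespace PointPattern

/-- The counting measure of a point pattern: `B ↦ φ(B)`, the number of points of `φ` in `B`. -/
def countingMeasure (φ : PointPattern) : Measure Plane :=
  Measure.count.restrict φ.carrier

/-- The usual σ-algebra on point patterns, generated by the counts `φ ↦ φ(B)`, `B` Borel. -/
instance : MeasurableSpace PointPattern :=
  MeasurableSpace.comap countingMeasure inferInstance

/-- The image of a point pattern under a bijective isometry of the plane. -/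
def map (e : Plane ≃ᵢ Plane) (φ : PointPattern) : PointPattern where
  carrier := e '' φ.carrier
  locallyFinite r := by
    refine ((φ.locallyFinite (r + dist (e 0) 0)).image e).subset ?_
    rintro _ ⟨⟨x, hx, rfl⟩, hr⟩
    refine ⟨x, ⟨hx, ?_⟩, rfl⟩
    rw [Metric.mem_closedBall] at hr ⊢
    calc dist x 0 = dist (e x) (e 0) := (e.isometry.dist_eq _ _).symm
      _ ≤ dist (e x) 0 + dist 0 (e 0) := dist_triangle _ _ _
      _ ≤ r + dist (e 0) 0 := by rw [dist_comm 0 (e 0)]; gcongr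

/-- The translate `φ + v = {x + v : x ∈ φ}`. -/
def translate (v : Plane) (φ : PointPattern) : PointPattern :=
  φ.map (IsometryEquiv.addRight v)

/-- `ζ` is a nearest point of `φ` to the origin. -/
def IsNearest (φ : PointPattern) (ζ : Plane) : Prop :=
  ζ ∈ φ.carrier ∧ ∀ x ∈ φ.carrier, ‖ζ‖ ≤ ‖x‖

/-- The distance `ξ` from the origin to the nearest point of `φ` (it is `∞` if `φ` is empty). -/
def contactDistance (φ : PointPattern) : ℝ≥0∞ := Metric.infEDist 0 φ.carrier

/-- The number of `n`-tuples of pairwise distinct points of `φ` that lie in `B`. -/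
def countTuples (φ : PointPattern) (n : ℕ) (B : Set (Fin n → Plane)) : ℝ≥0∞ :=
  (({x : Fin n → Plane | x ∈ B ∧ Function.Injective x ∧ ∀ i, x i ∈ φ.carrier}.encard : ℕ∞) : ℝ≥0∞)

/-! Measurability facts: they guarantee that the image and mixture measures below are the
intended ones. -/

lemma measurable_countingMeasure : Measurable countingMeasure :=
  comap_measurable _

lemma countable (φ : PointPattern) : φ.carrier.Countable := by
  have : φ.carrier = ⋃ n : ℕ, φ.carrier ∩ Metric.closedBall 0 (n : ℝ) := by
    rw [← Set.inter_iUnion, Metric.iUnion_closedBall_nat, Set.inter_univ]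
  rw [this]
  exact Set.countable_iUnion fun n => (φ.locallyFinite n).countable

lemma measurableSet_carrier (φ : PointPattern) : MeasurableSet φ.carrier :=
  φ.countable.measurableSet

lemma countingMeasure_map (e : Plane ≃ᵢ Plane) (φ : PointPattern) {B : Set Plane}
    (hB : MeasurableSet B) :
    (φ.map e).countingMeasure B = φ.countingMeasure (e ⁻¹' B) := by
  have he : MeasurableSet (e ⁻¹' B) := e.continuous.measurable hB
  rw [countingMeasure, countingMeasure, Measure.restrict_apply hB, Measure.restrict_apply he,
    Measure.count_apply (hB.inter (measurableSet_carrier _)),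
    Measure.count_apply (he.inter (measurableSet_carrier _))]
  have : B ∩ (φ.map e).carrier = e '' (e ⁻¹' B ∩ φ.carrier) := by
    rw [Set.inter_comm (e ⁻¹' B), Set.image_inter_preimage, Set.inter_comm]; rfl
  rw [this, e.injective.encard_image]

lemma measurable_of_counts {α : Type*} [MeasurableSpace α] {f : α → PointPattern}
    (h : ∀ B : Set Plane, MeasurableSet B → Measurable fun a => (f a).countingMeasure B) :
    Measurable f :=
  measurable_comap_iff.2 (Measure.measurable_of_measurable_coe _ h)

lemma measurable_map (e : Plane ≃ᵢ Plane) : Measurable (map e) := by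
  refine measurable_of_counts fun B hB => ?_
  simp_rw [countingMeasure_map e _ hB]
  exact (Measure.measurable_coe (e.continuous.measurable hB)).comp measurable_countingMeasure

/-- The counting measure as a kernel. -/
def countingKernel : Kernel PointPattern Plane := ⟨countingMeasure, measurable_countingMeasure⟩

instance : IsSFiniteKernel countingKernel := by
  classical
  let D : ℕ → Set Plane := disjointed fun n : ℕ => Metric.closedBall (0 : Plane) n
  have hD : ∀ k, MeasurableSet (D k) :=
    fun k => MeasurableSet.disjointed (fun _ => Metric.isClosed_closedBall.measurableSet) k
  have hN : ∀ k, Measurable fun φ : PointPattern => φ.countingMeasure (D k) := fun k =>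
    (Measure.measurable_coe (hD k)).comp measurable_countingMeasure
  have hs : ∀ k (n : ℕ), MeasurableSet {φ : PointPattern | φ.countingMeasure (D k) = n} :=
    fun k n => hN k (measurableSet_singleton _)
  let κ : ℕ × ℕ → Kernel PointPattern Plane := fun p =>
    Kernel.piecewise (hs p.1 p.2) (countingKernel.restrict (hD p.1)) 0
  have hκ : ∀ p, IsFiniteKernel (κ p) := fun p => by
    refine ⟨⟨p.2, ENNReal.natCast_lt_top _, fun φ => ?_⟩⟩
    by_cases h : φ.countingMeasure (D p.1) = p.2
    · simp only [κ, Kernel.piecewise_apply, Set.mem_ofPred_eq, h, if_true, Kernel.restrict_apply,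
        Measure.restrict_apply_univ]
      exact h.le
    · simp [κ, Kernel.piecewise_apply, h]
  have hsum : countingKernel = Kernel.sum κ := by
    ext φ : 1
    have hfin : ∀ k, ∃ n : ℕ, φ.countingMeasure (D k) = n := fun k => by
      have hf : (D k ∩ φ.carrier).Finite := (φ.locallyFinite (k : ℝ)).subset fun x hx =>
        ⟨hx.2, disjointed_subset (fun n : ℕ => Metric.closedBall (0 : Plane) n) k hx.1⟩
      refine ⟨hf.toFinset.card, ?_⟩
      rw [countingMeasure, Measure.restrict_apply (hD k), Measure.count_apply_finite _ hf]
    choose N hNk using hfin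
    have hU : φ.countingMeasure = Measure.sum fun k => φ.countingMeasure.restrict (D k) := by
      rw [← Measure.restrict_iUnion (disjoint_disjointed _) hD, iUnion_disjointed,
        Metric.iUnion_closedBall_nat, Measure.restrict_univ]
    change φ.countingMeasure = _
    refine Measure.ext fun B hB => ?_
    rw [Kernel.sum_apply, Measure.sum_apply _ hB, ENNReal.tsum_prod', hU, Measure.sum_apply _ hB]
    refine tsum_congr fun k => ?_
    rw [tsum_eq_single (N k)]
    · simp only [κ, Kernel.piecewise_apply, Set.mem_ofPred_eq, hNk k, if_true,
        Kernel.restrict_apply]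
      rfl
    · intro n hn
      have : (N k : ℝ≥0∞) ≠ n := fun h => hn (by exact_mod_cast h.symm)
      simp [κ, Kernel.piecewise_apply, hNk k, this]
  rw [hsum]
  exact Kernel.isSFiniteKernel_sum (hκs := fun p => inferInstance)

lemma measurable_translate_neg :
    Measurable fun p : PointPattern × Plane => p.1.translate (-p.2) := by
  refine measurable_of_counts fun B hB => ?_
  have h : ∀ p : PointPattern × Plane, (p.1.translate (-p.2)).countingMeasure B
      = ∫⁻ y, B.indicator 1 (y + -p.2) ∂(countingKernel p.1) := fun p => by
    rw [translate, countingMeasure_map _ _ hB]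
    have : (IsometryEquiv.addRight (-p.2) : Plane ≃ᵢ Plane) ⁻¹' B = (fun y => y + -p.2) ⁻¹' B := rfl
    rw [this, ← lintegral_indicator_one (hB.preimage (measurable_add_const _))]
    rfl
  simp_rw [h]
  have hm : Measurable fun q : (PointPattern × Plane) × Plane =>
      (B.indicator 1 (q.2 + -q.1.2) : ℝ≥0∞) :=
    (measurable_one.indicator hB).comp (by fun_prop)
  exact Measurable.lintegral_kernel_prod_right'
    (κ := countingKernel.comap Prod.fst measurable_fst) hm

end PointPattern

open PointPattern

/-! ### Palm distributions and conditional point processes -/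

/-- The unit square `[0,1)²`. -/
def unitSquare : Set Plane := {x | ∀ i, x i ∈ Set.Ico (0 : ℝ) 1}

/-- The intensity `λ` of a stationary point process with law `P`: the mean number of points in the
unit square. -/
def intensity (P : Measure PointPattern) : ℝ≥0∞ := ∫⁻ φ, φ.countingMeasure unitSquare ∂P

/-- The Palm distribution at the origin of a stationary point process with law `P`,
`A ↦ λ⁻¹ 𝔼 ∑_{x ∈ Φ ∩ [0,1)²} 𝟙_A(Φ - x)`. -/
def palmOrigin (P : Measure PointPattern) : Measure PointPattern :=
  (intensity P)⁻¹ • P.bind fun φ =>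
    (φ.countingMeasure.restrict unitSquare).map fun x => φ.translate (-x)

/-- The law of `Φ^ζ = (Φ ∣ ζ ∈ Φ)`: the Palm distribution at `ζ` (the point `ζ` is part of the
pattern). -/
def palm (P : Measure PointPattern) (ζ : Plane) : Measure PointPattern :=
  (palmOrigin P).map (PointPattern.translate ζ)

/-- The law of `Φ_o^ζ = (Φ ∣ NP_Φ(o) = ζ)`: the law of `Φ^ζ = (Φ ∣ ζ ∈ Φ)` conditioned on `ζ` being
the nearest point to the origin. -/
def nearestPalm (P : Measure PointPattern) (ζ : Plane) : Measure PointPattern :=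
  ProbabilityTheory.cond (palm P ζ) {φ | φ.IsNearest ζ}

lemma measurableSet_unitSquare : MeasurableSet unitSquare := by
  have : unitSquare = (WithLp.ofLp : Plane → Fin 2 → ℝ) ⁻¹' Set.univ.pi fun _ => Set.Ico 0 1 := by
    ext x; simp [unitSquare]
  rw [this]
  exact (MeasurableSet.univ_pi fun _ => measurableSet_Ico).preimage (by fun_prop)

lemma measurable_translate_neg_right (φ : PointPattern) :
    Measurable fun x : Plane => φ.translate (-x) :=
  Measurable.comp (g := fun p : PointPattern × Plane => p.1.translate (-p.2)) (f := Prod.mk φ)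
    measurable_translate_neg measurable_prodMk_left

/-- The mixture in `palmOrigin` is a mixture of a measurable family. -/
lemma measurable_palm_integrand :
    Measurable fun φ : PointPattern =>
      (φ.countingMeasure.restrict unitSquare).map fun x => φ.translate (-x) := by
  refine Measure.measurable_of_measurable_coe _ fun A hA => ?_
  have hS : MeasurableSet ((fun p : PointPattern × Plane => p.1.translate (-p.2)) ⁻¹' A ∩
      Prod.snd ⁻¹' unitSquare) :=
    (measurable_translate_neg hA).inter (measurable_snd measurableSet_unitSquare)
  convert Kernel.measurable_kernel_prodMk_left (κ := countingKernel) hS using 2 with φ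
  rw [Measure.map_apply (measurable_translate_neg_right φ) hA,
    Measure.restrict_apply (measurable_translate_neg_right φ hA)]
  congr 1

/-- The Palm distribution at the origin, evaluated on an event. -/
lemma palmOrigin_apply (P : Measure PointPattern) {A : Set PointPattern} (hA : MeasurableSet A) :
    palmOrigin P A = (intensity P)⁻¹ *
      ∫⁻ φ, φ.countingMeasure {x | x ∈ unitSquare ∧ φ.translate (-x) ∈ A} ∂P := by
  rw [palmOrigin, Measure.smul_apply, smul_eq_mul,
    Measure.bind_apply hA measurable_palm_integrand.aemeasurable]
  congr 1
  refine lintegral_congr fun φ => ?_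
  rw [Measure.map_apply (measurable_translate_neg_right φ) hA,
    Measure.restrict_apply (measurable_translate_neg_right φ hA), Set.inter_comm]
  congr 1

/-! ### Path loss, fading and interference -/

/-- The non-singular path loss `ℓ(x) = (1 + ‖x‖^α)⁻¹`. -/
def nonsingularPathLoss (α : ℝ) (x : Plane) : ℝ := (1 + ‖x‖ ^ α)⁻¹

/-- The singular path loss `ℓ(x) = ‖x‖^(-α)`. -/
def singularPathLoss (α : ℝ) (x : Plane) : ℝ := ‖x‖ ^ (-α)

/-- Composite fading: the law of `g * 10^(X/10)`, where `g` is gamma distributed with shape `m` and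
scale `1/m` (that is, rate `m`), `X` is normal with mean `0` and variance `σ²`, and `g` and `X` are
independent. -/
def compositeFading (m σ : ℝ) (hm : 0 < m) : ProbabilityMeasure ℝ :=
  ⟨((gammaMeasure m m).prod (gaussianReal 0 (σ ^ 2).toNNReal)).map
      fun p => p.1 * (10 : ℝ) ^ (p.2 / 10), by
    have := isProbabilityMeasure_gammaMeasure hm hm
    refine Measure.isProbabilityMeasure_map (Measurable.aemeasurable ?_)
    exact measurable_fst.mul (measurable_const.pow (measurable_snd.div_const _))⟩

/-- The interference at the origin from the points of `φ` in `S`,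
`∑_{x ∈ φ ∩ S} h_x ℓ(x) ∈ [0, ∞]`, for fading values `h`. -/
def interference (ℓ : Plane → ℝ) (S : Set Plane) (φ : PointPattern) (h : φ.carrier → ℝ) : ℝ≥0∞ :=
  ∑' x : φ.carrier, S.indicator (fun _ => ENNReal.ofReal (h x * ℓ x)) (x : Plane)

/-- The probability that the interference from the points in `S` exceeds `z`, when the points form
a point process with law `Q` and, given the points, the fading variables are i.i.d. with
law `F`. -/
def interferenceTail (ℓ : Plane → ℝ) (F : ProbabilityMeasure ℝ) (Q : Measure PointPattern)
    (S : Set Plane) (z : ℝ) : ℝ≥0∞ :=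
  ∫⁻ φ, Measure.infinitePi (fun _ : φ.carrier => (F : Measure ℝ))
    {h | ENNReal.ofReal z < interference ℓ S φ h} ∂Q

/-- The complementary distribution function `z ↦ ℙ(I > z)` of the total interference from the points
of `Φ_o^ζ` other than `ζ`. -/
def tailNearest (ℓ : Plane → ℝ) (F : ProbabilityMeasure ℝ) (P : Measure PointPattern) (ζ : Plane)
    (z : ℝ) : ℝ≥0∞ :=
  interferenceTail ℓ F (nearestPalm P ζ) {ζ}ᶜ z

/-- The complementary distribution function of the interference from the points of `Φ^ζ` other than
`ζ` and outside the open disk of radius `‖ζ‖ / 2`. -/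
def tailPalm (ℓ : Plane → ℝ) (F : ProbabilityMeasure ℝ) (P : Measure PointPattern) (ζ : Plane)
    (z : ℝ) : ℝ≥0∞ :=
  interferenceTail ℓ F (palm P ζ) ((Metric.ball 0 (‖ζ‖ / 2))ᶜ \ {ζ}) z

/-! ### The class of point process laws -/

/-- `P` is invariant under all translations of the plane. -/
def IsStationary (P : Measure PointPattern) : Prop :=
  ∀ v : Plane, P.map (PointPattern.translate v) = P

/-- `P` is invariant under all rotations of the plane about the origin. -/
def IsIsotropic (P : Measure PointPattern) : Prop :=
  ∀ R : Plane ≃ₗᵢ[ℝ] Plane, LinearMap.det (R.toLinearEquiv : Plane →ₗ[ℝ] Plane) = 1 →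
    P.map (PointPattern.map R.toIsometryEquiv) = P

/-- `P` is mixing: `P(A ∩ T_v B) → P(A) P(B)` as `‖v‖ → ∞`, for all events `A`, `B`. -/
def IsMixing (P : Measure PointPattern) : Prop :=
  ∀ A B : Set PointPattern, MeasurableSet A → MeasurableSet B →
    Tendsto (fun v : Plane => P (A ∩ PointPattern.translate v ⁻¹' B))
      (Bornology.cobounded Plane) (𝓝 (P A * P B))

/-- `ρ` is a density, with respect to Lebesgue measure, of the `n`-th factorial moment measure
`B ↦ 𝔼 #{(x₁, …, xₙ) ∈ B : x₁, …, xₙ ∈ Φ pairwise distinct}`. -/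
def IsMomentDensity (P : Measure PointPattern) (n : ℕ) (ρ : (Fin n → Plane) → ℝ≥0∞) : Prop :=
  Measurable ρ ∧ ∀ B : Set (Fin n → Plane), MeasurableSet B →
    ∫⁻ φ, φ.countTuples n B ∂P = ∫⁻ x in B, ρ x

/-- The set `𝒜` of laws of point processes, for the path loss `ℓ` and the fading law `F`. -/
structure ClassA (ℓ : Plane → ℝ) (F : ProbabilityMeasure ℝ) (P : Measure PointPattern) : Prop where
  isProbabilityMeasure : IsProbabilityMeasure P
  stationary : IsStationary P
  isotropic : IsIsotropic P
  mixing : IsMixing P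
  /-- For every `n ≥ 2` the `n`-th moment density exists and is bounded. -/
  momentDensity : ∀ n : ℕ, 2 ≤ n → ∃ (q : ℝ≥0) (ρ : (Fin n → Plane) → ℝ≥0∞),
    IsMomentDensity P n ρ ∧ ∀ x, ρ x < q
  /-- For every `y > 0`, with positive probability `Φ^ζ` has no point in the open disk `b(o, y)`,
  for some `ζ` with `‖ζ‖ = y`. -/
  emptyDisk : ∀ y : ℝ, 0 < y → ∃ ζ : Plane, ‖ζ‖ = y ∧
    palm P ζ {φ | φ.countingMeasure (Metric.ball 0 y) = 0} ≠ 0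
  /-- Stochastic dominance of the two interferences for all `ζ` far from the origin. -/
  domination : ∃ y₀ : ℝ, 0 < y₀ ∧ ∀ ζ : Plane, y₀ < ‖ζ‖ → ∀ z : ℝ, 0 ≤ z →
    tailNearest ℓ F P ζ z ≤ tailPalm ℓ F P ζ z
  /-- All moments of the contact distance are finite. -/
  contactMoments : ∀ n : ℕ, ∃ b : ℝ≥0, ∫⁻ φ, φ.contactDistance ^ n ∂P < b

end

end CellularNetwork

open CellularNetwork

namespace CellularNetwork

open PointPattern

/-! The interference has finite moments of every order, and Markov's inequality at order `β + 1`
then gives a tail `O(y^(-(β+1)))`, which is `o(y^(-β))`.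

If `ζ` is a nearest point, all interferers lie at distance at least `‖ζ‖ > 0`, so even the singular
path loss is harmless and `ℓ` may be replaced by `‖w‖^(-α)` cut off below `‖ζ‖`. Conditioning on
this event multiplies expectations of nonnegative variables by at most the inverse of its Palm
probability (`lintegral_nearestPalm_le`), and the fading, whose moments are all finite, contributes
only a factor (`infinitePi_interference_gt_le`). What remains is a moment of order `n + 1` of a shot
noise under the Palm law (`lintegral_palm_pow_lt_top`). The Palm formula turns it into an
expectation under `P` of a sum over the points of the unit square; recentring at any such point
changes the shot noise by at most a constant factor once it is majorised dyadically, and the number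
of terms costs one more power. So a moment of order `n + 2` under `P` suffices.

That moment is finite (`lintegral_dyadicMajorant_pow_lt_top`) because bounded moment densities make
the count in a disk of radius `2^j` of order `4^j` in every moment considered, while the path loss
there is of order `2^(-αj)`; the series converges since `α > 2`. -/

/-- Jensen's inequality for powers of a weighted series in `[0, ∞]`. -/
lemma tsum_mul_pow_le {ι : Type*} (w f : ι → ℝ≥0∞) (n : ℕ) :
    (∑' i, w i * f i) ^ (n + 1) ≤ (∑' i, w i) ^ n * ∑' i, w i * f i ^ (n + 1) := by
  have hp : (0 : ℝ) < (n + 1 : ℕ) := by positivity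
  have h : ∑' i, w i * f i ≤
      ((∑' i, w i) ^ n * ∑' i, w i * f i ^ (n + 1)) ^ ((n + 1 : ℕ) : ℝ)⁻¹ := by
    rw [ENNReal.tsum_eq_iSup_sum]
    refine iSup_le fun s => ?_
    refine (ENNReal.inner_le_weight_mul_Lp_of_nonneg s (p := ((n + 1 : ℕ) : ℝ))
      (by exact_mod_cast Nat.le_add_left 1 n) w f).trans ?_
    simp_rw [ENNReal.rpow_natCast]
    rw [ENNReal.mul_rpow_of_nonneg _ _ (inv_nonneg.2 hp.le), ← ENNReal.rpow_natCast,
      ← ENNReal.rpow_mul]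
    have he : (n : ℝ) * ((n + 1 : ℕ) : ℝ)⁻¹ = 1 - ((n + 1 : ℕ) : ℝ)⁻¹ := by
      push_cast; field_simp; ring
    have h0 : 0 ≤ 1 - ((n + 1 : ℕ) : ℝ)⁻¹ := he ▸ by positivity
    rw [he]
    gcongr
    · exact ENNReal.sum_le_tsum s
    · exact ENNReal.sum_le_tsum s
  calc (∑' i, w i * f i) ^ (n + 1)
      ≤ (((∑' i, w i) ^ n * ∑' i, w i * f i ^ (n + 1)) ^ ((n + 1 : ℕ) : ℝ)⁻¹) ^ (n + 1) := by
        gcongr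
    _ = _ := by rw [← ENNReal.rpow_natCast, ← ENNReal.rpow_mul, inv_mul_cancel₀ hp.ne',
        ENNReal.rpow_one]

/-! ### Moments of the fading -/

/-- Multiplying the gamma density of shape `a` by `x^(n+1)` gives a constant times the density of
shape `a + n + 1`. The exponent is positive, so nonpositive `x`, where `ENNReal.ofReal x` is zero,
contribute nothing. -/
lemma lintegral_pow_gammaMeasure_lt_top {a r : ℝ} (ha : 0 < a) (hr : 0 < r) (n : ℕ) :
    ∫⁻ x, ENNReal.ofReal x ^ (n + 1) ∂gammaMeasure a r < ∞ := by
  have hm : Measurable (gammaPDF a r) := (measurable_gammaPDFReal a r).ennreal_ofReal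
  rw [gammaMeasure, lintegral_withDensity_eq_lintegral_mul _ hm (by fun_prop)]
  have ha' : 0 < a + (n + 1 : ℕ) := by positivity
  have hΓ := Real.Gamma_pos_of_pos ha
  have hΓ' := Real.Gamma_pos_of_pos ha'
  set C : ℝ := Real.Gamma (a + (n + 1 : ℕ)) / (Real.Gamma a * r ^ (n + 1)) with hC
  have hC0 : 0 ≤ C := by positivity
  calc ∫⁻ x, (gammaPDF a r * fun x => ENNReal.ofReal x ^ (n + 1)) x
      ≤ ∫⁻ x, ENNReal.ofReal C * gammaPDF (a + (n + 1 : ℕ)) r x := by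
        refine lintegral_mono fun x => ?_
        rcases le_or_gt x 0 with hx | hx
        · simp [ENNReal.ofReal_of_nonpos hx]
        · simp only [Pi.mul_apply]
          rw [gammaPDF_of_nonneg hx.le, gammaPDF_of_nonneg hx.le, ← ENNReal.ofReal_pow hx.le,
            ← ENNReal.ofReal_mul (by positivity), ← ENNReal.ofReal_mul hC0]
          apply le_of_eq
          congr 1
          have h1 : x ^ (a + (n + 1 : ℕ) - 1) = x ^ (a - 1) * x ^ (n + 1) := by
            rw [← Real.rpow_natCast x (n + 1), ← Real.rpow_add hx]; congr 1; ring
          have h2 : r ^ (a + (n + 1 : ℕ)) = r ^ a * r ^ (n + 1) := by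
            rw [← Real.rpow_natCast r (n + 1), ← Real.rpow_add hr]
          rw [h1, h2, hC]
          field_simp
    _ < ∞ := by
        rw [lintegral_const_mul' _ _ ENNReal.ofReal_ne_top,
          lintegral_gammaPDF_eq_one ha' hr, mul_one]
        exact ENNReal.ofReal_lt_top

/-- By independence the moment factors. A power of `10^(X/10)` is the exponential of a multiple of
the Gaussian `X`, hence integrable. -/
lemma lintegral_pow_compositeFading_lt_top (m σ : ℝ) (hm : 0 < m) (n : ℕ) :
    ∫⁻ x, ENNReal.ofReal x ^ (n + 1) ∂(compositeFading m σ hm : Measure ℝ) < ∞ := by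
  have hmeas : Measurable fun p : ℝ × ℝ => p.1 * (10 : ℝ) ^ (p.2 / 10) :=
    measurable_fst.mul (measurable_const.pow (measurable_snd.div_const _))
  change ∫⁻ x, _ ∂(Measure.map _ _) < ∞
  rw [lintegral_map (by fun_prop) hmeas]
  have hsplit : ∀ p : ℝ × ℝ, ENNReal.ofReal (p.1 * (10 : ℝ) ^ (p.2 / 10)) ^ (n + 1) =
      ENNReal.ofReal p.1 ^ (n + 1) *
        ENNReal.ofReal (Real.exp (((n + 1 : ℕ) * (Real.log 10 / 10)) * p.2)) := fun p => by
    rw [Real.rpow_def_of_pos (by norm_num), ENNReal.ofReal_mul' (Real.exp_nonneg _), mul_pow,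
      ← ENNReal.ofReal_pow (Real.exp_nonneg _), ← Real.exp_nat_mul]
    congr 3
    ring
  simp_rw [hsplit]
  rw [lintegral_prod_mul (f := fun x => ENNReal.ofReal x ^ (n + 1))
    (g := fun y => ENNReal.ofReal (Real.exp (((n + 1 : ℕ) * (Real.log 10 / 10)) * y)))
    (by fun_prop) (by fun_prop)]
  refine ENNReal.mul_lt_top (lintegral_pow_gammaMeasure_lt_top hm hm n) ?_
  exact (integrable_exp_mul_gaussianReal _).lintegral_lt_top

/-- Moments of a sum of identically distributed terms with deterministic weights. -/
lemma lintegral_infinitePi_tsum_pow_le {ι : Type*} [Countable ι] (F : Measure ℝ)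
    [IsProbabilityMeasure F] (a : ι → ℝ≥0∞) (n : ℕ) :
    ∫⁻ h, (∑' i, a i * ENNReal.ofReal (h i)) ^ (n + 1) ∂Measure.infinitePi (fun _ : ι => F)
      ≤ (∫⁻ x, ENNReal.ofReal x ^ (n + 1) ∂F) * (∑' i, a i) ^ (n + 1) := by
  calc _ ≤ ∫⁻ h, (∑' i, a i) ^ n * ∑' i, a i * ENNReal.ofReal (h i) ^ (n + 1)
        ∂Measure.infinitePi (fun _ : ι => F) := lintegral_mono fun h => tsum_mul_pow_le _ _ n
    _ = (∑' i, a i) ^ n * ∑' i, a i * ∫⁻ x, ENNReal.ofReal x ^ (n + 1) ∂F := by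
        have hm : ∀ i, Measurable fun h : ι → ℝ => a i * ENNReal.ofReal (h i) ^ (n + 1) :=
          fun i => by fun_prop
        rw [lintegral_const_mul _ (Measurable.tsum hm),
          lintegral_tsum fun i => (hm i).aemeasurable]
        congr 1
        refine tsum_congr fun i => ?_
        rw [lintegral_const_mul _ (by fun_prop)]
        congr 1
        exact (measurePreserving_eval_infinitePi (fun _ : ι => F) i).lintegral_comp
          (f := fun x => ENNReal.ofReal x ^ (n + 1)) (by fun_prop)
    _ = _ := by rw [ENNReal.tsum_mul_right, pow_succ]; ring

/-! ### Integrals against the counting measure -/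

lemma lintegral_countingMeasure (φ : PointPattern) (f : Plane → ℝ≥0∞) :
    ∫⁻ x, f x ∂φ.countingMeasure = ∑' x : φ.carrier, f x := by
  rw [countingMeasure, lintegral_countable f φ.countable]
  simp

lemma lintegral_countingMeasure_map (e : Plane ≃ᵢ Plane) (φ : PointPattern) {f : Plane → ℝ≥0∞}
    (hf : Measurable f) :
    ∫⁻ x, f x ∂(φ.map e).countingMeasure = ∫⁻ x, f (e x) ∂φ.countingMeasure := by
  have : (φ.map e).countingMeasure = φ.countingMeasure.map e :=
    Measure.ext fun B hB => by
      rw [countingMeasure_map e φ hB, Measure.map_apply e.continuous.measurable hB]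
  rw [this, lintegral_map hf e.continuous.measurable]

lemma measurable_lintegral_countingMeasure {f : Plane → ℝ≥0∞} (hf : Measurable f) :
    Measurable fun φ : PointPattern => ∫⁻ x, f x ∂φ.countingMeasure :=
  (Measure.measurable_lintegral hf).comp measurable_countingMeasure

lemma measurable_countingMeasure_apply {B : Set Plane} (hB : MeasurableSet B) :
    Measurable fun φ : PointPattern => φ.countingMeasure B :=
  (Measure.measurable_coe hB).comp measurable_countingMeasure

lemma measurable_translate (v : Plane) : Measurable (PointPattern.translate v) :=
  measurable_map _

/-- Integration with respect to the Palm distribution. -/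
lemma lintegral_palm (P : Measure PointPattern) (ζ : Plane) {G : PointPattern → ℝ≥0∞}
    (hG : Measurable G) :
    ∫⁻ φ, G φ ∂palm P ζ = (intensity P)⁻¹ *
      ∫⁻ φ, ∫⁻ x in unitSquare, G ((φ.translate (-x)).translate ζ) ∂φ.countingMeasure ∂P := by
  have hGt : Measurable fun φ : PointPattern => G (φ.translate ζ) := hG.comp (measurable_translate ζ)
  rw [palm, lintegral_map hG (measurable_translate ζ), palmOrigin, lintegral_smul_measure, smul_eq_mul,
    Measure.lintegral_bind measurable_palm_integrand.aemeasurable hGt.aemeasurable]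
  congr 1
  refine lintegral_congr fun φ => ?_
  rw [lintegral_map hGt (measurable_translate_neg_right φ)]

/-- Markov's inequality for the interference, given the points. -/
lemma infinitePi_interference_gt_le (F : ProbabilityMeasure ℝ) {ℓ : Plane → ℝ} {a : Plane → ℝ≥0∞}
    {S : Set Plane} (φ : PointPattern) (hℓ : ∀ x, 0 ≤ ℓ x)
    (ha : ∀ x ∈ φ.carrier, x ∈ S → ENNReal.ofReal (ℓ x) ≤ a x) (n : ℕ) {y : ℝ} (hy : 0 < y) :
    Measure.infinitePi (fun _ : φ.carrier => (F : Measure ℝ))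
        {h | ENNReal.ofReal y < interference ℓ S φ h}
      ≤ (∫⁻ x, ENNReal.ofReal x ^ (n + 1) ∂(F : Measure ℝ)) / ENNReal.ofReal y ^ (n + 1) *
        (∫⁻ x, a x ∂φ.countingMeasure) ^ (n + 1) := by
  have := φ.countable.to_subtype
  have hle : ∀ h : φ.carrier → ℝ,
      interference ℓ S φ h ≤ ∑' x : φ.carrier, a x * ENNReal.ofReal (h x) := fun h => by
    refine ENNReal.tsum_le_tsum fun x => ?_
    by_cases hx : (x : Plane) ∈ S
    · rw [Set.indicator_of_mem hx, ENNReal.ofReal_mul' (hℓ x), mul_comm]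
      gcongr
      exact ha x x.2 hx
    · simp [hx]
  have hm : Measurable fun h : φ.carrier → ℝ =>
      (∑' x : φ.carrier, a x * ENNReal.ofReal (h x)) ^ (n + 1) :=
    (Measurable.tsum fun x => by fun_prop).pow_const _
  have hy' : ENNReal.ofReal y ^ (n + 1) ≠ 0 := pow_ne_zero _ (by simpa using hy)
  calc _ ≤ Measure.infinitePi (fun _ : φ.carrier => (F : Measure ℝ))
        {h | ENNReal.ofReal y ^ (n + 1) ≤
          (∑' x : φ.carrier, a x * ENNReal.ofReal (h x)) ^ (n + 1)} :=
        measure_mono fun h hh => pow_le_pow_left' ((le_of_lt hh).trans (hle h)) _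
    _ ≤ _ := meas_ge_le_lintegral_div hm.aemeasurable hy' (by finiteness)
    _ ≤ _ := ENNReal.div_le_div_right
        (lintegral_infinitePi_tsum_pow_le (F : Measure ℝ) (fun x : φ.carrier => a x) n) _
    _ = _ := by
      rw [lintegral_countingMeasure, ENNReal.mul_div_right_comm]

/-! ### Moments of the number of points in a ball -/

/-- Factorial moment densities control falling factorials, not powers. The two are comparable once
`n ≥ 2k`, where `n ≤ 2(n + 1 - k)`; smaller `n` are absorbed by the constant. -/
lemma pow_le_add_descFactorial (n k : ℕ) :
    n ^ k ≤ (2 * k) ^ k + 2 ^ k * n.descFactorial k := by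
  rcases le_total n (2 * k) with h | h
  · exact (Nat.pow_le_pow_left h k).trans (Nat.le_add_right _ _)
  · calc n ^ k ≤ (2 * (n + 1 - k)) ^ k := Nat.pow_le_pow_left (by omega) k
      _ = 2 ^ k * (n + 1 - k) ^ k := mul_pow _ _ _
      _ ≤ 2 ^ k * n.descFactorial k := Nat.mul_le_mul_left _ (Nat.pow_sub_le_descFactorial n k)
      _ ≤ _ := Nat.le_add_left _ _

/-- The falling factorial of the number of points in the disk counts the embeddings of `Fin k` into
these points, each of which is a tuple of distinct points. -/
lemma countingMeasure_pow_le_countTuples (φ : PointPattern) (k : ℕ) (R : ℝ) :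
    φ.countingMeasure (Metric.ball 0 R) ^ k ≤ ((2 * k) ^ k : ℕ) +
      2 ^ k * φ.countTuples k (Set.univ.pi fun _ => Metric.ball 0 R) := by
  have hfin : (Metric.ball 0 R ∩ φ.carrier).Finite :=
    (φ.locallyFinite R).subset fun x hx => ⟨hx.2, Metric.ball_subset_closedBall hx.1⟩
  have hN : φ.countingMeasure (Metric.ball 0 R) = (hfin.toFinset.card : ℝ≥0∞) := by
    rw [countingMeasure, Measure.restrict_apply Metric.isOpen_ball.measurableSet,
      Measure.count_apply_finite _ hfin]
  have htuples : (hfin.toFinset.card.descFactorial k : ℝ≥0∞) ≤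
      φ.countTuples k (Set.univ.pi fun _ => Metric.ball 0 R) := by
    let g : (Fin k ↪ hfin.toFinset) → (Fin k → Plane) := fun e i => (e i : Plane)
    have hg : Function.Injective g := fun e e' h => by
      ext i : 1
      exact Subtype.ext (congrFun h i)
    have hcard : (Set.range g).encard = (hfin.toFinset.card.descFactorial k : ℕ∞) := by
      rw [← Set.image_univ, hg.encard_image, Set.encard_univ, ENat.card_eq_coe_fintype_card,
        Fintype.card_embedding_eq, Fintype.card_coe, Fintype.card_fin]
    rw [countTuples, ← ENat.toENNReal_coe, ← hcard]
    refine ENat.toENNReal_le.2 (Set.encard_le_encard ?_)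
    rintro _ ⟨e, rfl⟩
    have he : ∀ i, (e i : Plane) ∈ Metric.ball 0 R ∩ φ.carrier := fun i =>
      hfin.mem_toFinset.1 (e i).2
    exact ⟨fun i _ => (he i).1, fun i j h => e.injective (Subtype.ext h), fun i => (he i).2⟩
  rw [hN]
  calc (hfin.toFinset.card : ℝ≥0∞) ^ k
      ≤ ((2 * k) ^ k : ℕ) + 2 ^ k * (hfin.toFinset.card.descFactorial k : ℝ≥0∞) := by
        exact_mod_cast pow_le_add_descFactorial hfin.toFinset.card k
    _ ≤ _ := by gcongr

/-- If the `k`-th moment density is bounded, the `k`-th moment of the number of points in a disk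
grows at most like the `k`-th power of the area. -/
lemma exists_lintegral_countingMeasure_ball_pow_le {P : Measure PointPattern}
    [IsProbabilityMeasure P] {k : ℕ} {q : ℝ≥0} {ρ : (Fin k → Plane) → ℝ≥0∞}
    (hρ : IsMomentDensity P k ρ) (hq : ∀ x, ρ x < q) :
    ∃ C : ℝ≥0∞, C ≠ ∞ ∧ ∀ R : ℝ, 1 ≤ R →
      ∫⁻ φ, φ.countingMeasure (Metric.ball 0 R) ^ k ∂P ≤ C * ENNReal.ofReal (R ^ 2) ^ k := by
  set v : ℝ≥0∞ := volume (Metric.ball (0 : Plane) 1)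
  have hv : v ≠ ∞ := measure_ball_lt_top.ne
  refine ⟨((2 * k) ^ k : ℕ) + 2 ^ k * (q * v ^ k), by finiteness, fun R hR => ?_⟩
  have hvol : volume (Metric.ball (0 : Plane) R) = ENNReal.ofReal (R ^ 2) * v := by
    rw [Measure.addHaar_ball _ _ (by linarith)]; simp [v]
  have hB : MeasurableSet (Set.univ.pi fun _ : Fin k => Metric.ball (0 : Plane) R) :=
    MeasurableSet.univ_pi fun _ => Metric.isOpen_ball.measurableSet
  -- The restriction to `R ≥ 1` serves to absorb the additive constant `(2k)^k` into the area term.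
  have hR1 : 1 ≤ ENNReal.ofReal (R ^ 2) ^ k := by
    refine one_le_pow₀ ?_
    rw [← ENNReal.ofReal_one]
    exact ENNReal.ofReal_le_ofReal (by nlinarith)
  calc ∫⁻ φ, φ.countingMeasure (Metric.ball 0 R) ^ k ∂P
      ≤ ∫⁻ φ, ((2 * k) ^ k : ℕ) +
          2 ^ k * φ.countTuples k (Set.univ.pi fun _ => Metric.ball 0 R) ∂P :=
        lintegral_mono fun φ => countingMeasure_pow_le_countTuples φ k R
    _ = ((2 * k) ^ k : ℕ) +
          2 ^ k * ∫⁻ x in Set.univ.pi fun _ => Metric.ball 0 R, ρ x := by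
        rw [lintegral_add_left measurable_const, lintegral_const_mul' _ _ (by finiteness),
          hρ.2 _ hB, lintegral_const, measure_univ, mul_one]
    _ ≤ ((2 * k) ^ k : ℕ) +
          2 ^ k * ∫⁻ x in Set.univ.pi fun _ : Fin k => Metric.ball (0 : Plane) R, (q : ℝ≥0∞) := by
        gcongr with x
        exact (hq x).le
    _ = ((2 * k) ^ k : ℕ) * 1 + 2 ^ k * (q * v ^ k) * ENNReal.ofReal (R ^ 2) ^ k := by
        rw [setLIntegral_const, volume_pi_pi]
        simp only [Finset.prod_const, Finset.card_univ, Fintype.card_fin, hvol]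
        rw [mul_pow]; ring
    _ ≤ _ := by
        rw [add_mul]
        gcongr

/-! ### A radial majorant of the path loss -/

/-- The radial step function `∑ⱼ rʲ 𝟙{‖x‖ < 2ʲ}`; for `r = 2^(-α)` it decays like `‖x‖^(-α)`. -/
noncomputable def dyadicMajorant (r : ℝ≥0∞) (x : Plane) : ℝ≥0∞ :=
  ∑' j : ℕ, r ^ j * (Metric.ball (0 : Plane) (2 ^ j)).indicator 1 x

lemma measurable_dyadicMajorant (r : ℝ≥0∞) : Measurable (dyadicMajorant r) :=
  Measurable.tsum fun _ =>
    (measurable_one.indicator Metric.isOpen_ball.measurableSet).const_mul _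

lemma pow_le_dyadicMajorant (r : ℝ≥0∞) {x : Plane} {j : ℕ} (hx : ‖x‖ < 2 ^ j) :
    r ^ j ≤ dyadicMajorant r x := by
  refine le_trans (le_of_eq ?_)
    (ENNReal.le_tsum (f := fun j => r ^ j * (Metric.ball (0 : Plane) (2 ^ j)).indicator 1 x) j)
  simp [hx]

lemma lintegral_dyadicMajorant (r : ℝ≥0∞) (φ : PointPattern) :
    ∫⁻ x, dyadicMajorant r x ∂φ.countingMeasure =
      ∑' j : ℕ, r ^ j * φ.countingMeasure (Metric.ball 0 (2 ^ j)) := by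
  have hm : ∀ j : ℕ, Measurable fun x : Plane =>
      r ^ j * (Metric.ball (0 : Plane) (2 ^ j)).indicator (1 : Plane → ℝ≥0∞) x := fun j =>
    (measurable_one.indicator Metric.isOpen_ball.measurableSet).const_mul _
  simp_rw [dyadicMajorant]
  rw [lintegral_tsum fun j => (hm j).aemeasurable]
  refine tsum_congr fun j => ?_
  rw [lintegral_const_mul _ (measurable_one.indicator Metric.isOpen_ball.measurableSet),
    lintegral_indicator_one Metric.isOpen_ball.measurableSet]

lemma norm_lt_two_of_mem_unitSquare {x : Plane} (hx : x ∈ unitSquare) : ‖x‖ < 2 := by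
  have h := EuclideanSpace.real_norm_sq_eq x
  rw [Fin.sum_univ_two] at h
  obtain ⟨h0, h0'⟩ := hx 0
  obtain ⟨h1, h1'⟩ := hx 1
  nlinarith [norm_nonneg x]

/-- Away from the origin, the power law path loss seen from any point of the unit square is
dominated by a multiple of the dyadic majorant. -/
lemma exists_rpow_neg_norm_le_dyadicMajorant {α : ℝ} (hα : 0 < α) {ζ : Plane} (hζ : ζ ≠ 0) :
    ∃ K : ℝ≥0∞, K ≠ ∞ ∧ ∀ x ∈ unitSquare, ∀ y : Plane, ‖ζ‖ ≤ ‖y + -x + ζ‖ →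
      ENNReal.ofReal (‖y + -x + ζ‖ ^ (-α)) ≤
        K * dyadicMajorant (ENNReal.ofReal (2 ^ (-α))) y := by
  have hζ' : 0 < ‖ζ‖ := norm_pos_iff.2 hζ
  -- Since `‖x‖ < 2` and `‖ζ‖ ≤ ‖w‖`, one has `‖y‖ ≤ 2‖w‖ + 2`. The least `j` with `‖y‖ < 2^j`
  -- satisfies `2^j ≤ 2‖y‖` or `j = 0`, so `2^j ≤ 4‖w‖ + 4`, and `1 ≤ ‖w‖ / ‖ζ‖` turns this into `D
  -- * ‖w‖`.
  set D : ℝ := 4 + 4 / ‖ζ‖ with hD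
  have hD0 : 0 < D := by positivity
  refine ⟨ENNReal.ofReal (D ^ α), ENNReal.ofReal_ne_top, fun x hx y hw => ?_⟩
  set w := y + -x + ζ with hwdef
  have hw0 : 0 < ‖w‖ := hζ'.trans_le hw
  have hx2 := norm_lt_two_of_mem_unitSquare hx
  have hone : 1 ≤ ‖w‖ / ‖ζ‖ := (one_le_div hζ').2 hw
  have hy : ‖y‖ ≤ 2 * ‖w‖ + 2 := by
    have h : y = w + x - ζ := by rw [hwdef]; abel
    calc ‖y‖ = ‖w + x - ζ‖ := by rw [← h]
      _ ≤ ‖w‖ + ‖x‖ + ‖ζ‖ := (norm_sub_le _ _).trans (by gcongr; exact norm_add_le _ _)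
      _ ≤ _ := by linarith
  have hDw : D * ‖w‖ = 4 * ‖w‖ + 4 * (‖w‖ / ‖ζ‖) := by rw [hD]; field_simp
  have hex : ∃ j : ℕ, ‖y‖ < 2 ^ j := pow_unbounded_of_one_lt _ one_lt_two
  obtain ⟨j, hj, hjD⟩ : ∃ j : ℕ, ‖y‖ < 2 ^ j ∧ (2 : ℝ) ^ j ≤ D * ‖w‖ := by
    classical
    refine ⟨Nat.find hex, Nat.find_spec hex, ?_⟩
    rcases h : Nat.find hex with _ | i
    · rw [pow_zero]; linarith
    · have := not_lt.1 (Nat.find_min hex (m := i) (by omega))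
      rw [pow_succ]; linarith
  have hle : ‖w‖ ^ (-α) ≤ D ^ α * (2 ^ (-α)) ^ j := by
    calc ‖w‖ ^ (-α) ≤ ((2 : ℝ) ^ j / D) ^ (-α) :=
          Real.rpow_le_rpow_of_nonpos (by positivity) (by rw [div_le_iff₀ hD0]; linarith)
            (by linarith)
      _ = _ := by
        rw [Real.div_rpow (by positivity) hD0.le, Real.rpow_neg hD0.le, div_inv_eq_mul, mul_comm,
          ← Real.rpow_natCast, ← Real.rpow_natCast, ← Real.rpow_mul zero_le_two,
          ← Real.rpow_mul zero_le_two, mul_comm (j : ℝ)]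
  calc ENNReal.ofReal (‖w‖ ^ (-α)) ≤ ENNReal.ofReal (D ^ α * (2 ^ (-α)) ^ j) :=
        ENNReal.ofReal_le_ofReal hle
    _ = ENNReal.ofReal (D ^ α) * ENNReal.ofReal (2 ^ (-α)) ^ j := by
        rw [ENNReal.ofReal_mul (by positivity), ENNReal.ofReal_pow (by positivity)]
    _ ≤ _ := by
        gcongr
        exact pow_le_dyadicMajorant _ hj

/-- Shot noise with a dyadic response function of integrable decay has finite moments. -/
lemma lintegral_dyadicMajorant_pow_lt_top {P : Measure PointPattern} [IsProbabilityMeasure P]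
    {n : ℕ} {q : ℝ≥0} {ρ : (Fin (n + 1) → Plane) → ℝ≥0∞} (hρ : IsMomentDensity P (n + 1) ρ)
    (hq : ∀ x, ρ x < q) {r : ℝ≥0∞} (hr : 4 * r < 1) :
    ∫⁻ φ, (∫⁻ x, dyadicMajorant r x ∂φ.countingMeasure) ^ (n + 1) ∂P < ∞ := by
  obtain ⟨C, hC, hCR⟩ := exists_lintegral_countingMeasure_ball_pow_le hρ hq
  have hgeom : ∑' j : ℕ, (4 * r) ^ j ≠ ∞ := by
    rw [ENNReal.tsum_geometric]
    exact ENNReal.inv_ne_top.2 (tsub_pos_of_lt hr).ne'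
  -- Normalising the counts by `4^j`, the order of the area, bounds their moments uniformly in `j`.
  -- The weights become `(4 * r)^j`, summable, and Jensen's inequality applies with these weights.
  let M : ℕ → PointPattern → ℝ≥0∞ := fun j φ =>
    (4 ^ j)⁻¹ * φ.countingMeasure (Metric.ball 0 (2 ^ j))
  have hM : ∀ j, Measurable (M j) := fun j =>
    (measurable_countingMeasure_apply Metric.isOpen_ball.measurableSet).const_mul _
  have hMC : ∀ j, ∫⁻ φ, M j φ ^ (n + 1) ∂P ≤ C := fun j => by
    have h4 : ENNReal.ofReal (((2 : ℝ) ^ j) ^ 2) = 4 ^ j := by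
      rw [← pow_mul, mul_comm, pow_mul, ENNReal.ofReal_pow (by positivity)]
      norm_num
    have hcancel : ((4 : ℝ≥0∞) ^ j)⁻¹ * 4 ^ j = 1 :=
      ENNReal.inv_mul_cancel (by positivity) (by finiteness)
    simp only [M, mul_pow]
    rw [lintegral_const_mul _ ((measurable_countingMeasure_apply
      Metric.isOpen_ball.measurableSet).pow_const _)]
    calc _ ≤ ((4 : ℝ≥0∞) ^ j)⁻¹ ^ (n + 1) * (C * (4 ^ j) ^ (n + 1)) := by
          gcongr
          rw [← h4]
          exact hCR _ (one_le_pow₀ one_le_two)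
      _ = C * ((4 ^ j)⁻¹ * 4 ^ j) ^ (n + 1) := by rw [mul_pow]; ring
      _ = C := by rw [hcancel, one_pow, mul_one]
  calc ∫⁻ φ, (∫⁻ x, dyadicMajorant r x ∂φ.countingMeasure) ^ (n + 1) ∂P
      = ∫⁻ φ, (∑' j, (4 * r) ^ j * M j φ) ^ (n + 1) ∂P := by
        refine lintegral_congr fun φ => ?_
        rw [lintegral_dyadicMajorant]
        congr 1
        refine tsum_congr fun j => ?_
        have hcancel : (4 : ℝ≥0∞) ^ j * (4 ^ j)⁻¹ = 1 :=
          ENNReal.mul_inv_cancel (by positivity) (by finiteness)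
        simp only [M, mul_pow]
        calc _ = (4 ^ j * (4 ^ j)⁻¹) * (r ^ j * φ.countingMeasure (Metric.ball 0 (2 ^ j))) := by
              rw [hcancel, one_mul]
          _ = _ := by ring
    _ ≤ ∫⁻ φ, (∑' j, (4 * r) ^ j) ^ n * ∑' j, (4 * r) ^ j * M j φ ^ (n + 1) ∂P :=
        lintegral_mono fun φ => tsum_mul_pow_le _ _ n
    _ = (∑' j, (4 * r) ^ j) ^ n * ∑' j, (4 * r) ^ j * ∫⁻ φ, M j φ ^ (n + 1) ∂P := by
        have hm : ∀ j, Measurable fun φ => (4 * r) ^ j * M j φ ^ (n + 1) := fun j =>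
          ((hM j).pow_const _).const_mul _
        rw [lintegral_const_mul _ (Measurable.tsum hm),
          lintegral_tsum fun j => (hm j).aemeasurable]
        congr 1
        exact tsum_congr fun j => lintegral_const_mul _ ((hM j).pow_const _)
    _ ≤ (∑' j, (4 * r) ^ j) ^ n * ∑' j, (4 * r) ^ j * C := by
        gcongr with j
        exact hMC j
    _ < ∞ := by
        rw [ENNReal.tsum_mul_right]
        finiteness

/-! ### Moments of the interference under the Palm distribution -/

/-- The inverse intensity is `∞` here, but it multiplies an integral equal to `0`, and `∞ * 0 = 0`.
This lets a conditioning event of nonzero Palm measure force a nonzero intensity. -/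
lemma palm_eq_zero_of_intensity_eq_zero {P : Measure PointPattern} (h : intensity P = 0)
    (ζ : Plane) : palm P ζ = 0 := by
  rw [← Measure.measure_univ_eq_zero, ← lintegral_one, lintegral_palm P ζ measurable_const]
  simp only [lintegral_one, Measure.restrict_apply_univ]
  rw [← intensity, h, mul_zero]

/-- Under the Palm distribution at `ζ`, the power law shot noise from the points that are at least
as far from the origin as `ζ` has finite moments. -/
lemma lintegral_palm_pow_lt_top {P : Measure PointPattern} [IsProbabilityMeasure P]
    {α : ℝ} (hα : 2 < α) (hP : intensity P ≠ 0) {n : ℕ} {q : ℝ≥0}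
    {ρ : (Fin (n + 2) → Plane) → ℝ≥0∞} (hρ : IsMomentDensity P (n + 2) ρ) (hq : ∀ x, ρ x < q)
    {ζ : Plane} (hζ : ζ ≠ 0) :
    ∫⁻ φ, (∫⁻ x, {w : Plane | ‖ζ‖ ≤ ‖w‖}.indicator (fun w => ENNReal.ofReal (‖w‖ ^ (-α))) x
      ∂φ.countingMeasure) ^ (n + 1) ∂palm P ζ < ∞ := by
  obtain ⟨K, hK, hKle⟩ := exists_rpow_neg_norm_le_dyadicMajorant (by linarith : 0 < α) hζ
  set r : ℝ≥0∞ := ENNReal.ofReal (2 ^ (-α)) with hrdef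
  have hr0 : r ≠ 0 := by rw [hrdef, ENNReal.ofReal_ne_zero_iff]; positivity
  -- This is where `α > 2` enters: `4 * 2^(-α) < 1`.
  have hr : 4 * r < 1 := by
    have h4 : (4 : ℝ≥0∞) = ENNReal.ofReal 4 := by norm_num
    rw [h4, ← ENNReal.ofReal_mul (by norm_num), ENNReal.ofReal_lt_one]
    have : (2 : ℝ) ^ (-α) < 2 ^ (-2 : ℝ) := Real.rpow_lt_rpow_of_exponent_lt one_lt_two (by linarith)
    have h2 : (2 : ℝ) ^ (-2 : ℝ) = 1 / 4 := by
      rw [Real.rpow_neg zero_le_two, Real.rpow_two]; norm_num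
    rw [h2] at this
    linarith
  set a : Plane → ℝ≥0∞ := {w : Plane | ‖ζ‖ ≤ ‖w‖}.indicator
    fun w => ENNReal.ofReal (‖w‖ ^ (-α)) with hadef
  have ha : Measurable a :=
    Measurable.indicator (by fun_prop) (measurableSet_le measurable_const measurable_norm)
  let V : PointPattern → ℝ≥0∞ := fun φ => ∫⁻ x, dyadicMajorant r x ∂φ.countingMeasure
  have hV : Measurable V := measurable_lintegral_countingMeasure (measurable_dyadicMajorant r)
  -- The bound does not depend on which point `x` of the square is moved to `ζ`, so the inner Palm
  -- sum is at most a constant times a count.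
  have hshift : ∀ φ : PointPattern, ∀ x ∈ unitSquare,
      ∫⁻ w, a w ∂((φ.translate (-x)).translate ζ).countingMeasure ≤ K * V φ := fun φ x hx => by
    rw [PointPattern.translate, lintegral_countingMeasure_map _ _ ha]
    simp only [IsometryEquiv.addRight_apply]
    rw [PointPattern.translate, lintegral_countingMeasure_map _ _ (f := fun w => a (w + ζ)) (ha.comp (measurable_add_const ζ)),
      ← lintegral_const_mul _ (measurable_dyadicMajorant r)]
    refine lintegral_mono fun y => ?_
    change a (y + -x + ζ) ≤ _
    by_cases hy : ‖ζ‖ ≤ ‖y + -x + ζ‖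
    · rw [hadef, Set.indicator_of_mem (by exact hy)]
      exact hKle x hx y hy
    · rw [hadef, Set.indicator_of_notMem (by exact hy)]
      exact zero_le
  -- The square lies in the disk of radius `2`, so its count appears, with weight `r`, in the `j =
  -- 1` term of `V`. This is the extra power of `V`.
  have hsquare : ∀ φ : PointPattern, φ.countingMeasure unitSquare ≤ r⁻¹ * V φ := fun φ => by
    rw [mul_comm, ← div_eq_mul_inv,
      ENNReal.le_div_iff_mul_le (Or.inl hr0) (Or.inl ENNReal.ofReal_ne_top), mul_comm]
    calc r * φ.countingMeasure unitSquare
        ≤ r ^ 1 * φ.countingMeasure (Metric.ball 0 (2 ^ 1)) := by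
          rw [pow_one, pow_one]
          gcongr
          exact fun x hx => mem_ball_zero_iff.2 (norm_lt_two_of_mem_unitSquare hx)
      _ ≤ ∑' j : ℕ, r ^ j * φ.countingMeasure (Metric.ball 0 (2 ^ j)) :=
          ENNReal.le_tsum (f := fun j => r ^ j * φ.countingMeasure (Metric.ball 0 (2 ^ j))) 1
      _ = V φ := (lintegral_dyadicMajorant r φ).symm
  rw [lintegral_palm P ζ ((measurable_lintegral_countingMeasure ha).pow_const _)]
  refine ENNReal.mul_lt_top (ENNReal.inv_lt_top.2 (pos_iff_ne_zero.2 hP)) ?_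
  calc _ ≤ ∫⁻ φ, ∫⁻ _ in unitSquare, (K * V φ) ^ (n + 1) ∂φ.countingMeasure ∂P :=
        lintegral_mono fun φ => setLIntegral_mono measurable_const fun x hx =>
          pow_le_pow_left' (hshift φ x hx) _
    _ ≤ ∫⁻ φ, K ^ (n + 1) * r⁻¹ * V φ ^ (n + 2) ∂P := by
        refine lintegral_mono fun φ => ?_
        rw [setLIntegral_const]
        calc _ ≤ (K * V φ) ^ (n + 1) * (r⁻¹ * V φ) := by gcongr; exact hsquare φ
          _ = _ := by ring
    _ = K ^ (n + 1) * r⁻¹ * ∫⁻ φ, V φ ^ (n + 2) ∂P := lintegral_const_mul _ (hV.pow_const _)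
    _ < ∞ := by
        have := ENNReal.inv_ne_top.2 hr0
        exact ENNReal.mul_lt_top (by finiteness)
          (lintegral_dyadicMajorant_pow_lt_top (n := n + 1) hρ hq hr)

/-! ### From Palm moments to the tail under conditioning -/

/-- Conditioning on `ζ` being a nearest point costs at most the inverse probability of that event. -/
lemma lintegral_nearestPalm_le (P : Measure PointPattern) (ζ : Plane)
    {f g : PointPattern → ℝ≥0∞} (hg : Measurable g)
    (hfg : ∀ φ : PointPattern, φ.IsNearest ζ → f φ ≤ g φ) :
    ∫⁻ φ, f φ ∂nearestPalm P ζ ≤ (palm P ζ {φ | φ.IsNearest ζ})⁻¹ * ∫⁻ φ, g φ ∂palm P ζ := by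
  rw [nearestPalm, ProbabilityTheory.cond, lintegral_smul_measure, smul_eq_mul]
  refine mul_le_mul_right ?_ _
  -- Only the majorant `g` has to be measurable; neither `f`, later the conditional tail given the
  -- points, nor the conditioning event needs to be.
  exact (setLIntegral_mono hg hfg).trans (setLIntegral_le_lintegral _ _)

/-- The origin is excluded from the bound because for `α > 0` the convention `0 ^ (-α) = 0` would
contradict the value `1` of the non-singular path loss there. -/
lemma pathLoss_nonneg_and_le {α : ℝ} {ℓ : Plane → ℝ}
    (hℓ : ℓ = nonsingularPathLoss α ∨ ℓ = singularPathLoss α) :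
    (∀ x, 0 ≤ ℓ x) ∧ ∀ x, x ≠ 0 → ℓ x ≤ ‖x‖ ^ (-α) := by
  rcases hℓ with rfl | rfl
  · refine ⟨fun x => by unfold nonsingularPathLoss; positivity, fun x hx => ?_⟩
    have hx' : 0 < ‖x‖ := norm_pos_iff.2 hx
    rw [nonsingularPathLoss, Real.rpow_neg hx'.le]
    exact inv_anti₀ (Real.rpow_pos_of_pos hx' α) (by linarith)
  · exact ⟨fun x => by unfold singularPathLoss; positivity, fun x _ => le_rfl⟩

/-- The tail of the interference decays at least as fast as any given power. -/
lemma exists_tailNearest_le {α : ℝ} (hα : 2 < α) {ℓ : Plane → ℝ}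
    (hℓ : ℓ = nonsingularPathLoss α ∨ ℓ = singularPathLoss α) {m σ : ℝ} (hm : 0 < m)
    {P : Measure PointPattern} (hP : ClassA ℓ (compositeFading m σ hm) P)
    {ζ : Plane} (hζ : ζ ≠ 0) (n : ℕ) :
    ∃ C : ℝ≥0∞, C ≠ ∞ ∧ ∀ y : ℝ, 0 < y →
      tailNearest ℓ (compositeFading m σ hm) P ζ y ≤ C / ENNReal.ofReal y ^ (n + 1) := by
  have := hP.isProbabilityMeasure
  obtain ⟨hℓ0, hℓle⟩ := pathLoss_nonneg_and_le hℓ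
  -- If the conditioning event is null, `ProbabilityTheory.cond` is the zero measure and the tail
  -- vanishes identically.
  by_cases hp : palm P ζ {φ | φ.IsNearest ζ} = 0
  · refine ⟨0, ENNReal.zero_ne_top, fun y _ => ?_⟩
    rw [tailNearest, interferenceTail, nearestPalm, cond_eq_zero_of_meas_eq_zero hp]
    simp
  have hint : intensity P ≠ 0 := fun h => hp (by
    rw [palm_eq_zero_of_intensity_eq_zero h]; simp)
  -- Order `n + 1` for Markov's inequality and one more for the Palm formula; the total is at least
  -- `2`, as the moment hypothesis demands.
  obtain ⟨q, ρ, hρ, hq⟩ := hP.momentDensity (n + 2) (by omega)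
  have hmom := lintegral_palm_pow_lt_top hα hint hρ hq hζ
  set a : Plane → ℝ≥0∞ := {w : Plane | ‖ζ‖ ≤ ‖w‖}.indicator
    fun w => ENNReal.ofReal (‖w‖ ^ (-α)) with hadef
  have ha : Measurable a :=
    Measurable.indicator (by fun_prop) (measurableSet_le measurable_const measurable_norm)
  have hM := lintegral_pow_compositeFading_lt_top m σ hm n
  set M := ∫⁻ x, ENNReal.ofReal x ^ (n + 1) ∂(compositeFading m σ hm : Measure ℝ)
  set T := ∫⁻ φ, (∫⁻ x, a x ∂φ.countingMeasure) ^ (n + 1) ∂palm P ζ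
  have hp' := ENNReal.inv_ne_top.2 hp
  refine ⟨(palm P ζ {φ | φ.IsNearest ζ})⁻¹ * (M * T), by finiteness, fun y hy => ?_⟩
  have hG := (measurable_lintegral_countingMeasure ha).pow_const (n + 1)
  calc tailNearest ℓ (compositeFading m σ hm) P ζ y
      ≤ (palm P ζ {φ | φ.IsNearest ζ})⁻¹ * ∫⁻ φ, M / ENNReal.ofReal y ^ (n + 1) *
          (∫⁻ x, a x ∂φ.countingMeasure) ^ (n + 1) ∂palm P ζ := by
        refine lintegral_nearestPalm_le P ζ (hG.const_mul _) fun φ hφ => ?_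
        refine infinitePi_interference_gt_le _ φ hℓ0 (fun x hx _ => ?_) n hy
        have hx' := hφ.2 x hx
        rw [hadef, Set.indicator_of_mem (by exact hx')]
        exact ENNReal.ofReal_le_ofReal
          (hℓle x (norm_pos_iff.1 ((norm_pos_iff.2 hζ).trans_le hx')))
    _ = _ := by
        rw [lintegral_const_mul _ hG, div_eq_mul_inv, div_eq_mul_inv]; ring

end CellularNetwork

theorem mainTheorem8 (α : ℝ) (hα : 2 < α) (ℓ : Plane → ℝ)
    (hℓ : ℓ = nonsingularPathLoss α ∨ ℓ = singularPathLoss α)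
    (m σ : ℝ) (hm : 0 < m) (hσ : 0 < σ)
    (P : Measure PointPattern) (hP : ClassA ℓ (compositeFading m σ hm) P)
    (ζ : Plane) (hζ : ζ ≠ 0) (β : ℕ) :
    (fun y : ℝ => (tailNearest ℓ (compositeFading m σ hm) P ζ y).toReal)
      =o[atTop] fun y : ℝ => y ^ (-(β : ℝ)) := by
  -- Taking `n = β` gives decay of order `β + 1`, one power more than needed, which turns the big-O
  -- into a little-o.
  obtain ⟨C, hC, hCle⟩ := exists_tailNearest_le hα hℓ hm hP hζ β
  have hO : (fun y : ℝ => (tailNearest ℓ (compositeFading m σ hm) P ζ y).toReal)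
      =O[atTop] fun y : ℝ => y ^ (-((β : ℝ) + 1)) := by
    refine IsBigO.of_bound C.toReal ?_
    filter_upwards [eventually_gt_atTop 0] with y hy
    have hy' : ENNReal.ofReal y ^ (β + 1) ≠ 0 := pow_ne_zero _ (by simpa using hy)
    rw [Real.norm_of_nonneg ENNReal.toReal_nonneg, Real.norm_of_nonneg (by positivity)]
    refine (ENNReal.toReal_mono (ENNReal.div_ne_top hC hy') (hCle y hy)).trans (le_of_eq ?_)
    rw [ENNReal.toReal_div, ENNReal.toReal_pow, ENNReal.toReal_ofReal hy.le, Real.rpow_neg hy.le,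
      div_eq_mul_inv, ← Real.rpow_natCast]
    push_cast
    rfl
  refine hO.trans_isLittleO (isLittleO_of_tendsto' ?_ ?_)
  · filter_upwards [eventually_gt_atTop 0] with y hy h
    exact absurd h (Real.rpow_pos_of_pos hy _).ne'
  · refine tendsto_inv_atTop_zero.congr' ?_
    filter_upwards [eventually_gt_atTop 0] with y hy
    rw [← Real.rpow_sub hy, ← Real.rpow_neg_one]
    congr 1
    ring
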